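/- Let $k$ be a field of characteristic zero, $P_n=k[x_1,\dots,x_n]$, let $W_n$ be the Lie algebra of $k$-linear derivations of $P_n$, and let $A_n\subseteq \mathrm{Hom}_k(P_n,P_n)$ be the Weyl algebra of linear differential operators on $P_n$, i.e. the algebra of operators generated by the multiplications by $x_1,\dots,x_n$ and by $\partial_1,\dots,\partial_n$, where $\partial_i=\partial/\partial x_i$. For $D,E\in W_n$ put $D\cdot E=\sum_j D(E(x_j))\,\partial_j$ (the left-symmetric product on derivations), and define the right powers of $D$ by $D^{[1]}=D$ and $D^{[m+1]}=D^{[m]}\cdot D$ for $m\ge 1$. Let $L_D\subseteq W_n$ be the Lie subalgebra, and $A_D\subseteq A_n$ the associative subalgebra with identity, generated by all $D^{[m]}$, $m\ge 1$. Let $\mathrm{NSymm}=k\langle Z_1,Z_2,\dots\rangle$ be the free associative algebra with the comultiplication $\Delta$ that is the algebra homomorphism given by $\Delta(Z_m)=\sum_{i+j=m}Z_i\otimes Z_j$ ($Z_0=1$), and let $\mathrm{Prim}=\{p\in \mathrm{NSymm}\mid \Delta(p)=p\otimes 1+1\otimes p\}$ be its Lie algebra of primitive elements. Let $F=(f_1,\dots,f_n)$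 be an $n$-tuple of elements of $P_n$, let $D=D_F=f_1\partial_1+\dots+f_n\partial_n$, and let $(X+tF)^*:P_n\to P_n[t]$ be the $k$-algebra homomorphism with $x_i\mapsto x_i+tf_i$. Let $\lambda:\mathrm{NSymm}\to \mathrm{Hom}_k(P_n,P_n)$ be the homomorphism of algebras with identity determined by $$(X+tF)^*(a)=\sum_{i\ge 0}t^i\,\lambda(Z_i)(a)\qquad\text{for all } a\in P_n .$$ Then $\lambda(\mathrm{Prim})=L_D$ and $\lambda(\mathrm{NSymm})=A_D$ (as sets of linear operators on $P_n$; in particular $\lambda(\mathrm{NSymm})\subseteq A_n$ and $\lambda(\mathrm{Prim})\subseteq W_n$). -/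

import Mathlib

open scoped TensorProduct

/- Associative algebras carry the commutator bracket. -/
attribute [local instance] LieRing.ofAssociativeRing

noncomputable section

namespace NSymmAction

/-- The underlying algebra of `NSymm`: the free associative `k`-algebra (with identity) on
`Z₁, Z₂, …`. -/
abbrev NSymm (k : Type*) [Field k] : Type _ := FreeAlgebra k ℕ+

/-- The elements `Z₀ = 1, Z₁, Z₂, …` of `NSymm`. -/
def Z (k : Type*) [Field k] : ℕ → NSymm k
  | 0 => 1
  | m + 1 => FreeAlgebra.ι k m.succPNat

/-- The comultiplication of `NSymm`: the algebra map with `Δ(Zₘ) = ∑_{i+j=m} Zᵢ ⊗ Zⱼ`. -/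
def comul (k : Type*) [Field k] : NSymm k →ₐ[k] NSymm k ⊗[k] NSymm k :=
  FreeAlgebra.lift k fun m : ℕ+ =>
    ∑ p ∈ Finset.HasAntidiagonal.antidiagonal (m : ℕ), Z k p.1 ⊗ₜ[k] Z k p.2

/-- The Lie algebra (for the commutator) of primitive elements of `NSymm`:
`Δ(p) = p ⊗ 1 + 1 ⊗ p`. -/
def Prim (k : Type*) [Field k] : LieSubalgebra k (NSymm k) where
  carrier := {p | comul k p = p ⊗ₜ[k] 1 + 1 ⊗ₜ[k] p}
  zero_mem' := by simp
  add_mem' := by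
    intro a b ha hb
    simp only [Set.mem_ofPred_eq] at ha hb ⊢
    rw [map_add, ha, hb, TensorProduct.add_tmul, TensorProduct.tmul_add]
    abel
  smul_mem' := by
    intro c a ha
    simp only [Set.mem_ofPred_eq] at ha ⊢
    rw [map_smul, ha, smul_add, TensorProduct.smul_tmul', TensorProduct.tmul_smul]
  lie_mem' := by
    intro a b ha hb
    change comul k a = a ⊗ₜ[k] 1 + 1 ⊗ₜ[k] a at ha
    change comul k b = b ⊗ₜ[k] 1 + 1 ⊗ₜ[k] b at hb
    change comul k ⁅a, b⁆ = ⁅a, b⁆ ⊗ₜ[k] 1 + 1 ⊗ₜ[k] ⁅a, b⁆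
    rw [Ring.lie_def, map_sub, map_mul, map_mul, ha, hb]
    simp only [add_mul, mul_add, Algebra.TensorProduct.tmul_mul_tmul, one_mul, mul_one,
      TensorProduct.sub_tmul, TensorProduct.tmul_sub]
    abel

/-- `Pₙ = k[x₁, …, xₙ]`. -/
abbrev P (k : Type*) [Field k] (n : ℕ) : Type _ := MvPolynomial (Fin n) k

/-- The Witt algebra `Wₙ`: the `k`-linear derivations of `Pₙ` with the commutator bracket. -/
abbrev W (k : Type*) [Field k] (n : ℕ) : Type _ := Derivation k (P k n) (P k n)

/-- The inclusion of `Wₙ` into the `k`-linear endomorphisms of `Pₙ`, a Lie homomorphism. -/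
def wittToEnd (k : Type*) [Field k] (n : ℕ) : W k n →ₗ⁅k⁆ Module.End k (P k n) where
  toFun D := (D : P k n →ₗ[k] P k n)
  map_add' _ _ := rfl
  map_smul' _ _ := rfl
  map_lie' := by
    intro D E
    exact Derivation.commutator_coe_linear_map

/-- The Weyl algebra `Aₙ` of linear differential operators with polynomial coefficients: the
algebra of operators on `Pₙ` generated by the multiplications by the `xᵢ` and the `∂ᵢ`. -/
def Weyl (k : Type*) [Field k] (n : ℕ) : Subalgebra k (Module.End k (P k n)) :=
  Algebra.adjoin k
    (Set.range (fun i : Fin n => LinearMap.mulLeft k (MvPolynomial.X i : P k n)) ∪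
      Set.range (fun j : Fin n => wittToEnd k n (MvPolynomial.pderiv j)))

theorem mulLeft_mem_weyl {k : Type*} [Field k] {n : ℕ} (a : P k n) :
    LinearMap.mulLeft k a ∈ Weyl k n := by
  have h : (⊤ : Subalgebra k (P k n)) ≤ (Weyl k n).comap (Algebra.lmul k (P k n)) := by
    rw [← MvPolynomial.adjoin_range_X, Algebra.adjoin_le_iff]
    rintro _ ⟨i, rfl⟩
    exact Algebra.subset_adjoin (Or.inl ⟨i, rfl⟩)
  exact h (Algebra.mem_top (x := a))

theorem wittToEnd_mem_weyl {k : Type*} [Field k] {n : ℕ} (D : W k n) :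
    wittToEnd k n D ∈ Weyl k n := by
  have h : wittToEnd k n D = ∑ i : Fin n,
      LinearMap.mulLeft k (D (MvPolynomial.X i)) * wittToEnd k n (MvPolynomial.pderiv i) := by
    have h1 : D = ∑ i : Fin n, D (MvPolynomial.X i) • MvPolynomial.pderiv i := by
      apply MvPolynomial.derivation_ext
      intro j
      have h2 := congrFun (map_sum (Derivation.coeFnAddMonoidHom (R := k) (A := P k n) (M := P k n))
        (fun i : Fin n => D (MvPolynomial.X i) • MvPolynomial.pderiv i) Finset.univ)
        (MvPolynomial.X j)
      simp only [Derivation.coeFnAddMonoidHom_apply, Finset.sum_apply] at h2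
      rw [h2, Finset.sum_eq_single j]
      · simp
      · intro b _ hb
        simp [MvPolynomial.pderiv_X_of_ne (Ne.symm hb)]
      · simp
    conv_lhs => rw [h1]
    rw [map_sum]
    rfl
  rw [h]
  exact Subalgebra.sum_mem _ fun i _ => Subalgebra.mul_mem _ (mulLeft_mem_weyl _)
    (Algebra.subset_adjoin (Or.inr ⟨i, rfl⟩))

/-- The inclusion of the derivations of `Pₙ` into the Weyl algebra `Aₙ`. -/
def wittToWeyl (k : Type*) [Field k] (n : ℕ) (D : W k n) : Weyl k n :=
  ⟨wittToEnd k n D, wittToEnd_mem_weyl D⟩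

/-- The derivation `D_F = f₁∂₁ + ⋯ + fₙ∂ₙ` attached to a tuple `F = (f₁, …, fₙ)`. -/
def derivOf {k : Type*} [Field k] {n : ℕ} (F : Fin n → P k n) : W k n :=
  ∑ i : Fin n, F i • MvPolynomial.pderiv i

/-- The product of the left-symmetric algebra of derivations:
`D · (∑ⱼ bⱼ∂ⱼ) = ∑ⱼ D(bⱼ)∂ⱼ`, where `bⱼ = E(xⱼ)` are the coefficients of `E`. This is the
bilinear extension of `(a∂ᵢ) · (b∂ⱼ) = ((a∂ᵢ)(b))∂ⱼ`. -/
def lsMul {k : Type*} [Field k] {n : ℕ} (D E : W k n) : W k n :=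
  ∑ j : Fin n, D (E (MvPolynomial.X j)) • MvPolynomial.pderiv j

/-- The right powers `D^[1] = D`, `D^[m+1] = D^[m] · D` (and `D^[0] = D`). -/
def rightPow {k : Type*} [Field k] {n : ℕ} (D : W k n) : ℕ → W k n
  | 0 => D
  | 1 => D
  | m + 2 => lsMul (rightPow D (m + 1)) D

/-- `L_D`: the Lie subalgebra of `Wₙ` generated by all right powers `D^[m]`, `m ≥ 1`. -/
def lieAlg {k : Type*} [Field k] {n : ℕ} (D : W k n) : LieSubalgebra k (W k n) :=
  LieSubalgebra.lieSpan k (W k n) {E | ∃ m : ℕ, 1 ≤ m ∧ E = rightPow D m}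

/-- `A_D`: the subalgebra with identity of the Weyl algebra `Aₙ` generated by all right powers
`D^[m]`, `m ≥ 1`. -/
def assocAlg {k : Type*} [Field k] {n : ℕ} (D : W k n) : Subalgebra k (Weyl k n) :=
  Algebra.adjoin k {T | ∃ m : ℕ, 1 ≤ m ∧ T = wittToWeyl k n (rightPow D m)}

/-- `(X + tF)^* : Pₙ → Pₙ[t]`, the `k`-algebra homomorphism with `xᵢ ↦ xᵢ + t fᵢ`. -/
def pullback {k : Type*} [Field k] {n : ℕ} (F : Fin n → P k n) :
    P k n →ₐ[k] Polynomial (P k n) :=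
  MvPolynomial.aeval fun i =>
    Polynomial.C (MvPolynomial.X i) + Polynomial.X * Polynomial.C (F i)

/-- The operator sending `a` to the coefficient of `t^m` in `(X + tF)^*(a)`. -/
def coeffOp {k : Type*} [Field k] {n : ℕ} (F : Fin n → P k n) (m : ℕ) :
    Module.End k (P k n) :=
  ((Polynomial.lcoeff (P k n) m).restrictScalars k) ∘ₗ (pullback F).toLinearMap

/-- The representation `λ` of `NSymm` on `Pₙ` with
`(X + tF)^*(a) = a + t λ(Z₁)(a) + t² λ(Z₂)(a) + ⋯` for all `a`. -/
def rep {k : Type*} [Field k] {n : ℕ} (F : Fin n → P k n) :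
    NSymm k →ₐ[k] Module.End k (P k n) :=
  FreeAlgebra.lift k fun m : ℕ+ => coeffOp F m

end NSymmAction

end

noncomputable section

namespace NSymmAction

/-! Write `Z(t) = ∑ Zₘ tᵐ` and take its logarithmic derivative `N(t)`, defined by `Z' = N Z`. Since
`Z(t)` is group-like, the coefficients of `N` (the Newton primitives) are primitive. In
characteristic zero `Z` is recovered from `N` by solving the differential equation, so they generate
`NSymm`. Comparing `NSymm` with the free algebra on primitive generators, Friedrichs' theorem
(`mem_freeLie_of_primitive`) shows that they generate `Prim` as a Lie algebra (`prim_eq_lieSpan`).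

Under `λ`, `Z(t)` becomes `φ = (X+tF)^*`. Let `V = ∑ (-1)ᵐ tᵐ D^[m+1]`. Its defining recursion says
`V(x_l + t f_l) = f_l`, so `dφ/dt` and `V ∘ φ` are derivations along `φ` that agree on the
variables, hence equal (`coeffOp_succ`). Thus `λ` sends `N` to `V`, and the Newton primitives to the
right powers of `D` up to sign. Both equalities follow by comparing generators. -/

open PowerSeries in
/-- The formal derivative of a power series over a possibly noncommutative ring. -/
def deriv {R : Type*} [Ring R] (f : R⟦X⟧) : R⟦X⟧ :=
  PowerSeries.mk fun m => (m + 1) • PowerSeries.coeff (m + 1) f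

/-! ### Logarithmic derivatives of noncommutative power series -/

section LogDerivative

open PowerSeries

variable {R S : Type*} [Ring R] [Ring S]

@[simp]
theorem coeff_deriv (f : R⟦X⟧) (m : ℕ) : coeff m (deriv f) = (m + 1) • coeff (m + 1) f :=
  coeff_mk _ _

theorem deriv_mul (f g : R⟦X⟧) : deriv (f * g) = deriv f * g + f * deriv g := by
  ext m
  rw [coeff_deriv, coeff_mul, map_add, coeff_mul, coeff_mul, Finset.smul_sum]
  -- The factor `m + 1 = i + j` on each term is split into `i` and `j`, one for each half of the
  -- Leibniz rule.
  have h1 : ∑ p ∈ Finset.HasAntidiagonal.antidiagonal (m + 1), (p.1 • (coeff p.1 f * coeff p.2 g)) =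
      ∑ p ∈ Finset.HasAntidiagonal.antidiagonal m, coeff p.1 (deriv f) * coeff p.2 g := by
    rw [Finset.Nat.sum_antidiagonal_succ]
    simp [mul_assoc]
  have h2 : ∑ p ∈ Finset.HasAntidiagonal.antidiagonal (m + 1), (p.2 • (coeff p.1 f * coeff p.2 g)) =
      ∑ p ∈ Finset.HasAntidiagonal.antidiagonal m, coeff p.1 f * coeff p.2 (deriv g) := by
    rw [Finset.Nat.sum_antidiagonal_succ']
    simp only [coeff_deriv, mul_smul_comm, zero_smul, zero_add]
  rw [← h1, ← h2, ← Finset.sum_add_distrib]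
  refine Finset.sum_congr rfl fun p hp => ?_
  rw [← add_smul, Finset.HasAntidiagonal.mem_antidiagonal.1 hp]

theorem deriv_map (φ : R →+* S) (f : R⟦X⟧) : deriv (f.map φ) = (deriv f).map φ := by
  ext m
  simp

theorem eq_of_mul_eq_mul_of_constantCoeff_one {x y z : R⟦X⟧} (hz : constantCoeff z = 1)
    (h : x * z = y * z) : x = y := by
  have hu : IsUnit z := isUnit_iff_constantCoeff.2 (by simp [hz])
  exact hu.mul_left_injective h

theorem exists_deriv_eq_mul {z : R⟦X⟧} (hz : constantCoeff z = 1) :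
    ∃ x : R⟦X⟧, deriv z = x * z :=
  ⟨deriv z * invOfUnit z 1, by rw [mul_assoc, invOfUnit_mul z 1 (by simp [hz]), mul_one]⟩

/-- If the series `x'` commutes with `z`, logarithmic derivatives of products add up. -/
theorem deriv_mul_eq_of_commute {x x' z z' : R⟦X⟧} (h : deriv z = x * z) (h' : deriv z' = x' * z')
    (hc : Commute x' z) : deriv (z * z') = (x + x') * (z * z') := by
  rw [deriv_mul, h, h', ← mul_assoc z, ← hc.eq]
  noncomm_ring

/-- The equation expresses `m + 1` times the coefficient of degree `m + 1` through lower ones, and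
`m + 1` is invertible. This uniqueness replaces explicit Newton-type formulas below. -/
theorem eq_of_deriv_eq_mul {x z z' : R⟦X⟧} (h : deriv z = x * z) (h' : deriv z' = x * z')
    (h0 : constantCoeff z = constantCoeff z') (k : Type*) [Field k] [CharZero k] [Algebra k R] :
    z = z' := by
  have key : ∀ m, ∀ i ≤ m, coeff i z = coeff i z' := by
    intro m
    induction m with
    | zero =>
      intro i hi
      obtain rfl : i = 0 := by omega
      simpa using h0
    | succ m ih =>
      intro i hi
      rcases hi.lt_or_eq with hi | rfl
      · exact ih i (by omega)
      have e : (m + 1) • coeff (m + 1) z = (m + 1) • coeff (m + 1) z' := by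
        rw [← coeff_deriv, ← coeff_deriv, h, h', coeff_mul, coeff_mul]
        refine Finset.sum_congr rfl fun p hp => ?_
        rw [ih p.2 (Finset.HasAntidiagonal.antidiagonal.snd_le hp)]
      have hm : ((m + 1 : ℕ) : k) ≠ 0 := by exact_mod_cast m.succ_ne_zero
      rw [← Nat.cast_smul_eq_nsmul k, ← Nat.cast_smul_eq_nsmul k (m + 1)] at e
      exact smul_right_injective R hm e
  ext m
  exact key m m le_rfl

/-- The coefficients of the solution of `z' = x z`, `z(0) = 1`. -/
def expCoeff (k : Type*) [Field k] {R : Type*} [Ring R] [Algebra k R] (x : ℕ → R) : ℕ → R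
  | 0 => 1
  | m + 1 => ((m + 1 : ℕ) : k)⁻¹ • ∑ i : Fin (m + 1), x i * expCoeff k x (m - i)
decreasing_by omega

theorem deriv_expCoeff {k : Type*} [Field k] [CharZero k] [Algebra k R]
    (x : ℕ → R) :
    deriv (PowerSeries.mk (expCoeff k x)) = PowerSeries.mk x * PowerSeries.mk (expCoeff k x) := by
  ext m
  have hm : ((m + 1 : ℕ) : k) ≠ 0 := by exact_mod_cast m.succ_ne_zero
  rw [coeff_deriv, coeff_mk, expCoeff, ← Nat.cast_smul_eq_nsmul k, smul_inv_smul₀ hm, coeff_mul]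
  simp only [coeff_mk]
  rw [Finset.Nat.sum_antidiagonal_eq_sum_range_succ (fun i j => x i * expCoeff k x j),
    Finset.sum_range]

end LogDerivative

/-! ### Friedrichs' theorem via the Dynkin operator -/

section Friedrichs

variable (k : Type*) [Field k] (X : Type*)

/-- The comultiplication of the free algebra for which the generators are primitive. -/
def freeComul : FreeAlgebra k X →ₐ[k] FreeAlgebra k X ⊗[k] FreeAlgebra k X :=
  FreeAlgebra.lift k fun x => FreeAlgebra.ι k x ⊗ₜ[k] 1 + 1 ⊗ₜ[k] FreeAlgebra.ι k x

/-- The anti-automorphism of the free algebra sending each generator to its negative. -/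
def freeAntipode : FreeAlgebra k X →ₗ[k] FreeAlgebra k X :=
  (MulOpposite.opLinearEquiv k).symm.toLinearMap ∘ₗ
    (FreeAlgebra.lift k fun x => MulOpposite.op (-FreeAlgebra.ι k x)).toLinearMap

/-- The algebra map `a ↦ a + ε Y(a)` to the dual numbers with `Y(x) = x` on generators. -/
def freeEulerHom : FreeAlgebra k X →ₐ[k] TrivSqZeroExt (FreeAlgebra k X) (FreeAlgebra k X) :=
  FreeAlgebra.lift k fun x =>
    TrivSqZeroExt.inl (FreeAlgebra.ι k x) + TrivSqZeroExt.inr (FreeAlgebra.ι k x)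

/-- The Euler derivation of the free algebra, multiplying words by their length. -/
def freeEuler : FreeAlgebra k X →ₗ[k] FreeAlgebra k X :=
  TrivSqZeroExt.sndHom (FreeAlgebra k X) (FreeAlgebra k X) |>.restrictScalars k |>.comp
    (freeEulerHom k X).toLinearMap

/-- The Lie subalgebra of the free algebra generated by the generators. -/
def freeLie : LieSubalgebra k (FreeAlgebra k X) :=
  LieSubalgebra.lieSpan k _ (Set.range (FreeAlgebra.ι k))

variable {k X}

@[simp]
theorem freeComul_ι (x : X) : freeComul k X (FreeAlgebra.ι k x) =
    FreeAlgebra.ι k x ⊗ₜ[k] 1 + 1 ⊗ₜ[k] FreeAlgebra.ι k x := by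
  simp [freeComul]

@[simp]
theorem freeAntipode_one : freeAntipode k X 1 = 1 := by simp [freeAntipode]

theorem freeAntipode_mul_ι (w : FreeAlgebra k X) (x : X) :
    freeAntipode k X (w * FreeAlgebra.ι k x) = -(FreeAlgebra.ι k x * freeAntipode k X w) := by
  simp [freeAntipode]

theorem fst_freeEulerHom (w : FreeAlgebra k X) : (freeEulerHom k X w).fst = w := by
  have h : (TrivSqZeroExt.fstHom k (FreeAlgebra k X) (FreeAlgebra k X)).comp (freeEulerHom k X) =
      AlgHom.id k _ := by
    apply FreeAlgebra.hom_ext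
    ext x
    simp [freeEulerHom]
  exact DFunLike.congr_fun h w

theorem freeEuler_mul (a b : FreeAlgebra k X) :
    freeEuler k X (a * b) = freeEuler k X a * b + a * freeEuler k X b := by
  change (freeEulerHom k X (a * b)).snd = (freeEulerHom k X a).snd * b +
    a * (freeEulerHom k X b).snd
  rw [map_mul, TrivSqZeroExt.snd_mul, fst_freeEulerHom, fst_freeEulerHom, add_comm]
  rfl

@[simp]
theorem freeEuler_ι (x : X) : freeEuler k X (FreeAlgebra.ι k x) = FreeAlgebra.ι k x := by
  change (freeEulerHom k X (FreeAlgebra.ι k x)).snd = _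
  simp [freeEulerHom]

@[simp]
theorem freeEuler_one : freeEuler k X 1 = 0 := by
  change (freeEulerHom k X 1).snd = _
  simp

theorem ι_mem_freeLie (x : X) : FreeAlgebra.ι k x ∈ freeLie k X :=
  LieSubalgebra.subset_lieSpan ⟨x, rfl⟩

theorem freeEuler_mem_freeLie {a : FreeAlgebra k X} (ha : a ∈ freeLie k X) :
    freeEuler k X a ∈ freeLie k X := by
  suffices a ∈ freeLie k X ∧ freeEuler k X a ∈ freeLie k X from this.2
  unfold freeLie at ha
  induction ha using LieSubalgebra.lieSpan_induction with
  | mem x h =>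
    obtain ⟨x, rfl⟩ := h
    simpa using ι_mem_freeLie x
  | zero => simp
  | smul r x hx h =>
    rw [map_smul]
    exact ⟨(freeLie k X).smul_mem r h.1, (freeLie k X).smul_mem r h.2⟩
  | add x y hx hy h h' => rw [map_add]; exact ⟨add_mem h.1 h'.1, add_mem h.2 h'.2⟩
  | lie x y hx hy h h' =>
    refine ⟨(freeLie k X).lie_mem h.1 h'.1, ?_⟩
    have e : freeEuler k X ⁅x, y⁆ = ⁅freeEuler k X x, y⁆ + ⁅x, freeEuler k X y⁆ := by
      simp only [Ring.lie_def, map_sub, freeEuler_mul]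
      abel
    rw [e]
    exact add_mem ((freeLie k X).lie_mem h.2 h'.1) ((freeLie k X).lie_mem h.1 h'.2)

/-- Induction over words, extended by generators on the right. -/
theorem freeAlgebra_word_induction {p : FreeAlgebra k X → Prop} (zero : p 0) (one : p 1)
    (add : ∀ a b, p a → p b → p (a + b)) (smul : ∀ (c : k) a, p a → p (c • a))
    (mul_ι : ∀ a x, a ∈ Submonoid.closure (Set.range (FreeAlgebra.ι k : X → _)) → p a →
      p (a * FreeAlgebra.ι k x)) (a : FreeAlgebra k X) : p a := by
  have ha : a ∈ Submodule.span k (Submonoid.closure (Set.range (FreeAlgebra.ι k : X → _)) :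
      Set (FreeAlgebra k X)) := by
    rw [← Algebra.adjoin_eq_span, FreeAlgebra.adjoin_range_ι]
    trivial
  induction ha using Submodule.span_induction with
  | mem x h =>
    induction h using Submonoid.closure_induction_right with
    | one => exact one
    | mul_right w hw y hy ih =>
      obtain ⟨y, rfl⟩ := hy
      exact mul_ι _ _ hw ih
  | zero => exact zero
  | add a b _ _ ha hb => exact add a b ha hb
  | smul c a _ ha => exact smul c a ha

/-- `S * id` in the convolution algebra takes scalar values. -/
theorem antipode_convolution_id (a : FreeAlgebra k X) :
    ∃ c : k, LinearMap.mul' k _ (TensorProduct.map (freeAntipode k X) LinearMap.id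
      (freeComul k X a)) = algebraMap k _ c := by
  -- On `a ⊗ b`, multiplication by `x ⊗ 1 + 1 ⊗ x` gives `S(ax)b + S(a)bx = -xS(a)b + S(a)bx`. Hence
  -- a scalar value for `a` forces the value zero for `ax`.
  have key : ∀ (t : FreeAlgebra k X ⊗[k] FreeAlgebra k X) (x : X),
      LinearMap.mul' k _ (TensorProduct.map (freeAntipode k X) LinearMap.id
        (t * freeComul k X (FreeAlgebra.ι k x))) =
      ⁅LinearMap.mul' k _ (TensorProduct.map (freeAntipode k X) LinearMap.id t),
        FreeAlgebra.ι k x⁆ := by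
    intro t x
    induction t using TensorProduct.induction_on with
    | zero => simp
    | tmul a b =>
      simp [mul_add, freeAntipode_mul_ι, Ring.lie_def, mul_assoc]
      abel
    | add s t hs ht => simp only [add_mul, map_add, hs, ht, add_lie]
  induction a using freeAlgebra_word_induction with
  | zero => exact ⟨0, by simp⟩
  | one => exact ⟨1, by simp [Algebra.TensorProduct.one_def]⟩
  | add a b ha hb =>
    obtain ⟨c, hc⟩ := ha
    obtain ⟨d, hd⟩ := hb
    exact ⟨c + d, by simp only [map_add, hc, hd]⟩
  | smul r a ha =>
    obtain ⟨c, hc⟩ := ha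
    exact ⟨r * c, by rw [map_smul, map_smul, map_smul, hc, map_mul, Algebra.smul_def]⟩
  | mul_ι a x _ ha =>
    obtain ⟨c, hc⟩ := ha
    exact ⟨0, by rw [map_mul, key, hc, Ring.lie_def, Algebra.commutes, sub_self, map_zero]⟩

variable (k X) in
/-- The convolution of the antipode with the Euler derivation (the Dynkin operator). -/
def dynkin : FreeAlgebra k X →ₗ[k] FreeAlgebra k X :=
  LinearMap.mul' k _ ∘ₗ TensorProduct.map (freeAntipode k X) (freeEuler k X) ∘ₗ
    (freeComul k X).toLinearMap

/-- The bracket arises as for `S * id`; the extra term is the Leibniz contribution `S(a)·b·Y(x)`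
with `Y(x) = x`. Its first factor is scalar, so Lie membership propagates along words. -/
theorem dynkin_mul_ι (a : FreeAlgebra k X) (x : X) :
    dynkin k X (a * FreeAlgebra.ι k x) = ⁅dynkin k X a, FreeAlgebra.ι k x⁆ +
      LinearMap.mul' k _ (TensorProduct.map (freeAntipode k X) LinearMap.id (freeComul k X a)) *
        FreeAlgebra.ι k x := by
  simp only [dynkin, LinearMap.comp_apply, AlgHom.toLinearMap_apply, map_mul]
  generalize freeComul k X a = t
  induction t using TensorProduct.induction_on with
  | zero => simp
  | tmul a b =>
    simp [mul_add, freeAntipode_mul_ι, freeEuler_mul, Ring.lie_def, mul_assoc]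
    abel
  | add s t hs ht =>
    simp only [add_mul, map_add, hs, ht, add_lie]
    abel

theorem dynkin_mem_freeLie (a : FreeAlgebra k X) : dynkin k X a ∈ freeLie k X := by
  induction a using freeAlgebra_word_induction with
  | zero => simp
  | one => simp [dynkin, Algebra.TensorProduct.one_def]
  | add a b ha hb => rw [map_add]; exact add_mem ha hb
  | smul r a ha => rw [map_smul]; exact (freeLie k X).smul_mem r ha
  | mul_ι a x _ ha =>
    obtain ⟨c, hc⟩ := antipode_convolution_id a
    rw [dynkin_mul_ι, hc, ← Algebra.smul_def]
    exact add_mem ((freeLie k X).lie_mem ha (ι_mem_freeLie x))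
      ((freeLie k X).smul_mem c (ι_mem_freeLie x))

/-- Of `S(p)Y(1) + S(1)Y(p)` only the second term survives, as `Y(1) = 0`. -/
theorem dynkin_of_primitive {p : FreeAlgebra k X} (hp : freeComul k X p = p ⊗ₜ 1 + 1 ⊗ₜ p) :
    dynkin k X p = freeEuler k X p := by
  simp [dynkin, hp]

/-- Applying `ε ⊗ ε` to `Δ(p)` gives `ε(p) = 2ε(p)`. -/
theorem algebraMapInv_of_primitive {p : FreeAlgebra k X}
    (hp : freeComul k X p = p ⊗ₜ 1 + 1 ⊗ₜ p) : FreeAlgebra.algebraMapInv p = (0 : k) := by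
  let ε : FreeAlgebra k X →ₐ[k] k := FreeAlgebra.algebraMapInv
  let m := Algebra.TensorProduct.lift ε ε fun _ _ => Commute.all _ _
  have h : m.comp (freeComul k X) = ε := by
    apply FreeAlgebra.hom_ext
    ext x
    simp [m, ε, FreeAlgebra.algebraMapInv]
  have h' : m (freeComul k X p) = ε p := DFunLike.congr_fun h p
  rw [hp] at h'
  simpa [m] using h'

theorem freeEuler_word {w : FreeAlgebra k X}
    (hw : w ∈ Submonoid.closure (Set.range (FreeAlgebra.ι k : X → _))) :
    ∃ d : ℕ, freeEuler k X w = (d : k) • w := by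
  induction hw using Submonoid.closure_induction_right with
  | one => exact ⟨0, by simp⟩
  | mul_right w hw y hy ih =>
    obtain ⟨y, rfl⟩ := hy
    obtain ⟨d, hd⟩ := ih
    refine ⟨d + 1, ?_⟩
    rw [freeEuler_mul, hd, freeEuler_ι, smul_mul_assoc]
    push_cast
    rw [add_smul, one_smul]

-- A polynomial in `Y` with constant term 1 can kill all nonempty words occurring in `a`, while
-- fixing scalars. It stands in for the grading by length and allows `Y` to be inverted on the
-- kernel of `ε`.
open Polynomial in
theorem exists_aeval_freeEuler [CharZero k] (a : FreeAlgebra k X) :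
    ∃ q : k[X], q.coeff 0 = 1 ∧ aeval (freeEuler k X : Module.End k (FreeAlgebra k X)) q a =
      algebraMap k _ (FreeAlgebra.algebraMapInv a) := by
  have hc : ∀ (q : k[X]) (c : k), q.coeff 0 = 1 →
      aeval (freeEuler k X : Module.End k (FreeAlgebra k X)) q (algebraMap k _ c) =
        algebraMap k _ c := by
    intro q c hq
    have h0 : freeEuler k X (algebraMap k _ c) = 0 := by
      rw [Algebra.algebraMap_eq_smul_one, map_smul, freeEuler_one, smul_zero]
    rw [← divX_mul_X_add q, hq, map_add, map_mul, aeval_X, LinearMap.add_apply,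
      Module.End.mul_apply, h0, map_zero, zero_add]
    simp
  induction a using freeAlgebra_word_induction with
  | zero => exact ⟨1, by simp⟩
  | one => exact ⟨1, by simp⟩
  | add a b ha hb =>
    obtain ⟨q, hq, h⟩ := ha
    obtain ⟨r, hr, h'⟩ := hb
    refine ⟨q * r, by rw [mul_coeff_zero, hq, hr, one_mul], ?_⟩
    have ea : aeval (freeEuler k X : Module.End k (FreeAlgebra k X)) (q * r) a =
        algebraMap k _ (FreeAlgebra.algebraMapInv a) := by
      rw [mul_comm, map_mul, Module.End.mul_apply, h, hc r _ hr]
    have eb : aeval (freeEuler k X : Module.End k (FreeAlgebra k X)) (q * r) b =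
        algebraMap k _ (FreeAlgebra.algebraMapInv b) := by
      rw [map_mul, Module.End.mul_apply, h', hc q _ hq]
    rw [map_add, ea, eb, map_add, map_add]
  | smul c a ha =>
    obtain ⟨q, hq, h⟩ := ha
    exact ⟨q, hq, by rw [map_smul, h, map_smul, Algebra.smul_def, smul_eq_mul, map_mul]⟩
  | mul_ι a x hw _ =>
    obtain ⟨d, hd⟩ := freeEuler_word hw
    -- The word has length `d + 1`, its eigenvalue under `Y`.
    refine ⟨1 - C ((d + 1 : ℕ) : k)⁻¹ * Polynomial.X, by simp, ?_⟩
    have hd1 : ((d + 1 : ℕ) : k) ≠ 0 := by exact_mod_cast d.succ_ne_zero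
    have h1 : freeEuler k X (a * FreeAlgebra.ι k x) =
        ((d + 1 : ℕ) : k) • (a * FreeAlgebra.ι k x) := by
      rw [freeEuler_mul, hd, freeEuler_ι, smul_mul_assoc]
      push_cast
      rw [add_smul, one_smul]
    rw [map_sub, map_mul (aeval _), aeval_X, aeval_C, LinearMap.sub_apply, Module.End.mul_apply, h1,
      Module.algebraMap_end_apply, inv_smul_smul₀ hd1]
    simp [FreeAlgebra.algebraMapInv]

open Polynomial in
/-- **Friedrichs' theorem**: primitive elements of a free algebra in characteristic zero are
Lie elements. -/
theorem mem_freeLie_of_primitive [CharZero k] {p : FreeAlgebra k X}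
    (hp : freeComul k X p = p ⊗ₜ 1 + 1 ⊗ₜ p) : p ∈ freeLie k X := by
  obtain ⟨q, hq, h⟩ := exists_aeval_freeEuler p
  have hE : freeEuler k X p ∈ freeLie k X := by
    rw [← dynkin_of_primitive hp]
    exact dynkin_mem_freeLie p
  have hst : ∀ (r : k[X]) (b : FreeAlgebra k X), b ∈ freeLie k X →
      aeval (freeEuler k X : Module.End k (FreeAlgebra k X)) r b ∈ freeLie k X := by
    intro r b hb
    induction r using Polynomial.induction_on' generalizing b with
    | add r s hr hs => rw [map_add]; exact add_mem (hr b hb) (hs b hb)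
    | monomial n c =>
      rw [aeval_monomial, Module.End.mul_apply, Module.algebraMap_end_apply]
      refine (freeLie k X).smul_mem c ?_
      induction n with
      | zero => simpa using hb
      | succ n ih =>
        rw [pow_succ']
        exact freeEuler_mem_freeLie ih
  -- Writing `q = q.divX * X + 1`, the relation `q(Y)p = 0` expresses `p` as a polynomial in `Y`
  -- applied to the Lie element `Y(p)`.
  rw [algebraMapInv_of_primitive hp, map_zero, ← divX_mul_X_add q, hq, map_add, map_mul, aeval_X,
    LinearMap.add_apply, Module.End.mul_apply] at h
  have h1 : p = -aeval (freeEuler k X : Module.End k (FreeAlgebra k X)) q.divX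
      (freeEuler k X p) := by
    rw [eq_neg_iff_add_eq_zero, add_comm]
    simpa using h
  rw [h1]
  exact neg_mem (hst _ _ hE)

end Friedrichs

/-! ### The logarithmic derivative of `(X+tF)^*` -/

section Representation

variable {k : Type*} [Field k] {n : ℕ} (F : Fin n → P k n)

theorem sum_smul_pderiv_X (f : Fin n → P k n) (l : Fin n) :
    (∑ i : Fin n, f i • MvPolynomial.pderiv i : W k n) (MvPolynomial.X l) = f l := by
  have h := congrFun (map_sum (Derivation.coeFnAddMonoidHom (R := k) (A := P k n) (M := P k n))
    (fun i : Fin n => f i • MvPolynomial.pderiv i) Finset.univ) (MvPolynomial.X l)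
  simp only [Derivation.coeFnAddMonoidHom_apply, Finset.sum_apply] at h
  rw [h, Finset.sum_eq_single l]
  · simp
  · intro b _ hb
    simp [MvPolynomial.pderiv_X_of_ne (Ne.symm hb)]
  · simp

/-- The right powers of `D_F` with alternating signs. -/
def signedPow (m : ℕ) : W k n := (-1 : k) ^ m • rightPow (derivOf F) (m + 1)

theorem signedPow_zero_X (l : Fin n) : signedPow F 0 (MvPolynomial.X l) = F l := by
  simp only [signedPow, pow_zero, one_smul]
  exact sum_smul_pderiv_X F l

/-- Together with the case `m = 0` this says `V(x_l) = f_l - t V(f_l)` for the generating series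
`V`. -/
theorem signedPow_succ_X (m : ℕ) (l : Fin n) :
    signedPow F (m + 1) (MvPolynomial.X l) = -signedPow F m (F l) := by
  have h1 : rightPow (derivOf F) (m + 1 + 1) (MvPolynomial.X l) =
      rightPow (derivOf F) (m + 1) (F l) := by
    change lsMul (rightPow (derivOf F) (m + 1)) (derivOf F) (MvPolynomial.X l) = _
    rw [lsMul, sum_smul_pderiv_X, derivOf, sum_smul_pderiv_X]
  simp only [signedPow, Derivation.smul_apply, h1, pow_succ, mul_neg, mul_one, neg_smul]

theorem coeffOp_apply (m : ℕ) (a : P k n) : coeffOp F m a = (pullback F a).coeff m := rfl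

theorem pullback_mul_X (a : P k n) (l : Fin n) : pullback F (a * MvPolynomial.X l) =
    pullback F a * Polynomial.C (MvPolynomial.X l) +
      pullback F a * Polynomial.C (F l) * Polynomial.X := by
  rw [map_mul]
  simp only [pullback, MvPolynomial.aeval_X]
  ring

theorem coeffOp_zero_mul_X (a : P k n) (l : Fin n) :
    coeffOp F 0 (a * MvPolynomial.X l) = coeffOp F 0 a * MvPolynomial.X l := by
  simp [coeffOp_apply, pullback_mul_X]

theorem coeffOp_succ_mul_X (m : ℕ) (a : P k n) (l : Fin n) :
    coeffOp F (m + 1) (a * MvPolynomial.X l) =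
      coeffOp F (m + 1) a * MvPolynomial.X l + coeffOp F m a * F l := by
  simp [coeffOp_apply, pullback_mul_X]

theorem coeffOp_C (m : ℕ) (c : k) :
    coeffOp F m (MvPolynomial.C c) = if m = 0 then MvPolynomial.C c else 0 := by
  rw [coeffOp_apply, ← MvPolynomial.algebraMap_eq, AlgHom.commutes, Polynomial.algebraMap_apply,
    Polynomial.coeff_C]

theorem coeffOp_zero : coeffOp F 0 = 1 := by
  refine LinearMap.ext fun a => ?_
  induction a using MvPolynomial.induction_on with
  | C c => simp [coeffOp_C]
  | add p q hp hq => rw [map_add, hp, hq, map_add]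
  | mul_X p l hp => rw [coeffOp_zero_mul_X, hp]; rfl

/-- This is `dφ/dt = V ∘ φ` in degree `m`. The induction multiplies `a` by one variable at a time,
using Leibniz on both sides. -/
theorem coeffOp_succ (m : ℕ) (a : P k n) : (m + 1) • coeffOp F (m + 1) a =
    ∑ p ∈ Finset.HasAntidiagonal.antidiagonal m, signedPow F p.1 (coeffOp F p.2 a) := by
  induction a using MvPolynomial.induction_on generalizing m with
  | C c =>
    rw [coeffOp_C, if_neg m.succ_ne_zero, smul_zero]
    refine (Finset.sum_eq_zero fun p _ => ?_).symm
    rw [coeffOp_C]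
    split_ifs
    · rw [← MvPolynomial.algebraMap_eq, Derivation.map_algebraMap]
    · rw [map_zero]
  | add p q hp hq => simp only [map_add, smul_add, hp, hq, Finset.sum_add_distrib]
  | mul_X a l ih =>
    cases m with
    | zero =>
      have h := ih 0
      simp only [Finset.HasAntidiagonal.antidiagonal_zero, Finset.sum_singleton, zero_add, one_smul] at h ⊢
      rw [coeffOp_zero_mul_X, ← zero_add 1, coeffOp_succ_mul_X, Derivation.leibniz, ← h,
        signedPow_zero_X, smul_eq_mul, smul_eq_mul]
      ring
    | succ m =>
      have h1 := ih (m + 1)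
      have h2 := ih m
      rw [Finset.Nat.sum_antidiagonal_succ'] at h1 ⊢
      simp only [coeffOp_succ_mul_X, coeffOp_zero_mul_X, map_add, Derivation.leibniz,
        smul_eq_mul, Finset.sum_add_distrib] at h1 ⊢
      -- The coefficient of `t^(m+1)` in `φ(a)V(x_l) = φ(a)f_l - t φ(a)V(f_l)`.
      have h3 : coeffOp F 0 a * signedPow F (m + 1) (MvPolynomial.X l) +
          ∑ p ∈ Finset.HasAntidiagonal.antidiagonal m,
            coeffOp F (p.2 + 1) a * signedPow F p.1 (MvPolynomial.X l) =
          coeffOp F (m + 1) a * F l - ∑ p ∈ Finset.HasAntidiagonal.antidiagonal m,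
            coeffOp F p.2 a * signedPow F p.1 (F l) := by
        rw [← Finset.Nat.sum_antidiagonal_succ'
          (f := fun p => coeffOp F p.2 a * signedPow F p.1 (MvPolynomial.X l)),
          Finset.Nat.sum_antidiagonal_succ, signedPow_zero_X]
        simp only [signedPow_succ_X, mul_neg, Finset.sum_neg_distrib]
        ring
      rw [← Finset.mul_sum, ← Finset.mul_sum, ← h2]
      simp only [nsmul_eq_mul] at h1 ⊢
      push_cast at h1 ⊢
      linear_combination MvPolynomial.X l * h1 - h3

theorem deriv_coeffOp : deriv (PowerSeries.mk (coeffOp F)) =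
    PowerSeries.mk (fun m => wittToEnd k n (signedPow F m)) * PowerSeries.mk (coeffOp F) := by
  refine PowerSeries.ext fun m => LinearMap.ext fun a => ?_
  rw [coeff_deriv, PowerSeries.coeff_mul]
  simp only [PowerSeries.coeff_mk, LinearMap.sum_apply]
  exact coeffOp_succ F m a

end Representation

/-! ### Group-like series in the tensor square -/

section TensorSeries

open PowerSeries Algebra.TensorProduct

variable {k : Type*} [Field k] {R : Type*} [Ring R] [Algebra k R]

theorem coeff_map_includeLeft_mul_map_includeRight (z z' : R⟦X⟧) (m : ℕ) :
    coeff m (z.map (includeLeft : R →ₐ[k] R ⊗[k] R).toRingHom *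
      z'.map (includeRight : R →ₐ[k] R ⊗[k] R).toRingHom) =
      ∑ p ∈ Finset.HasAntidiagonal.antidiagonal m, coeff p.1 z ⊗ₜ[k] coeff p.2 z' := by
  simp [coeff_mul]

theorem commute_map_includeRight_map_includeLeft (x z : R⟦X⟧) :
    Commute (x.map (includeRight : R →ₐ[k] R ⊗[k] R).toRingHom)
      (z.map (includeLeft : R →ₐ[k] R ⊗[k] R).toRingHom) := by
  ext m
  rw [coeff_map_includeLeft_mul_map_includeRight, coeff_mul,
    ← Finset.Nat.sum_antidiagonal_swap]
  simp

/-- The two tensor factors commute, so the logarithmic derivatives add: group-like series have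
primitive ones. -/
theorem deriv_map_includeLeft_mul_map_includeRight {x z : R⟦X⟧} (h : deriv z = x * z) :
    deriv (z.map (includeLeft : R →ₐ[k] R ⊗[k] R).toRingHom *
      z.map (includeRight : R →ₐ[k] R ⊗[k] R).toRingHom) =
    (x.map (includeLeft : R →ₐ[k] R ⊗[k] R).toRingHom +
      x.map (includeRight : R →ₐ[k] R ⊗[k] R).toRingHom) *
    (z.map (includeLeft : R →ₐ[k] R ⊗[k] R).toRingHom *
      z.map (includeRight : R →ₐ[k] R ⊗[k] R).toRingHom) :=
  deriv_mul_eq_of_commute (by rw [deriv_map, h, map_mul]) (by rw [deriv_map, h, map_mul])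
    (commute_map_includeRight_map_includeLeft x z)

end TensorSeries

/-! ### Newton primitives as generators of `NSymm` and `Prim` -/

section Newton

open PowerSeries Algebra.TensorProduct

variable (k : Type*) [Field k]

theorem Z_pnat (m : ℕ+) : Z k m = FreeAlgebra.ι k m := by
  obtain ⟨m, hm⟩ := m
  obtain ⟨m, rfl⟩ := Nat.exists_eq_succ_of_ne_zero hm.ne'
  rfl

theorem map_Z_eq {B : Type*} [Ring B] [Algebra k B] (φ : NSymm k →ₐ[k] B) (b : ℕ → B)
    (h0 : b 0 = 1) (h : ∀ m : ℕ+, φ (FreeAlgebra.ι k m) = b m) (m : ℕ) : φ (Z k m) = b m := by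
  rcases Nat.eq_zero_or_pos m with rfl | hm
  · rw [h0]; exact map_one φ
  · exact (congrArg φ (Z_pnat k ⟨m, hm⟩)).trans (h ⟨m, hm⟩)

theorem comul_Z (m : ℕ) : comul k (Z k m) =
    ∑ p ∈ Finset.HasAntidiagonal.antidiagonal m, Z k p.1 ⊗ₜ[k] Z k p.2 :=
  map_Z_eq k (comul k)
    (fun m => ∑ p ∈ Finset.HasAntidiagonal.antidiagonal m, Z k p.1 ⊗ₜ[k] Z k p.2)
    (by simp [Z, Algebra.TensorProduct.one_def]) (fun m => by simp [comul]) m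

theorem exists_newton :
    ∃ x : ℕ → NSymm k, deriv (PowerSeries.mk (Z k)) = PowerSeries.mk x * PowerSeries.mk (Z k) := by
  obtain ⟨x, hx⟩ := exists_deriv_eq_mul (z := PowerSeries.mk (Z k)) (by simp [Z])
  refine ⟨fun m => coeff m x, ?_⟩
  rw [hx]
  congr 1
  ext m
  simp

/-- The Newton primitives of `NSymm`: the coefficients of the logarithmic derivative
`Z'(t) Z(t)⁻¹`. -/
def newton : ℕ → NSymm k := (exists_newton k).choose

theorem deriv_Z :
    deriv (PowerSeries.mk (Z k)) = PowerSeries.mk (newton k) * PowerSeries.mk (Z k) :=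
  (exists_newton k).choose_spec

variable {k} in
/-- The image of the Newton primitives under an algebra map is determined by the logarithmic
derivative of the image of `Z(t)`. -/
theorem map_newton_eq {B : Type*} [Ring B] [Algebra k B] (φ : NSymm k →ₐ[k] B) {z x : B⟦X⟧}
    (hz : ∀ m, φ (Z k m) = coeff m z) (h : deriv z = x * z) (m : ℕ) :
    φ (newton k m) = coeff m x := by
  have hz' : (PowerSeries.mk (Z k)).map φ.toRingHom = z := by
    ext m
    simp [hz]
  have h1 : (PowerSeries.mk (newton k)).map φ.toRingHom = x := by
    refine eq_of_mul_eq_mul_of_constantCoeff_one (z := z) ?_ ?_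
    · rw [← coeff_zero_eq_constantCoeff_apply, ← hz]
      exact map_one φ
    · rw [← h, ← hz', deriv_map, deriv_Z, map_mul]
  rw [← h1]
  simp

theorem newton_mem_prim (m : ℕ) : newton k m ∈ Prim k := by
  change comul k (newton k m) = _
  rw [map_newton_eq (comul k) (fun m => ?_)
    (deriv_map_includeLeft_mul_map_includeRight (deriv_Z k))]
  · simp
  · rw [coeff_map_includeLeft_mul_map_includeRight, comul_Z]
    simp

/-- The algebra map from `NSymm` to the free algebra on the Newton primitives. -/
def toFree : NSymm k →ₐ[k] FreeAlgebra k ℕ :=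
  FreeAlgebra.lift k fun m => expCoeff k (FreeAlgebra.ι k) m

/-- The algebra map from the free algebra to `NSymm` sending generators to Newton primitives. -/
def ofFree : FreeAlgebra k ℕ →ₐ[k] NSymm k :=
  FreeAlgebra.lift k (newton k)

theorem toFree_Z (m : ℕ) : toFree k (Z k m) = expCoeff k (FreeAlgebra.ι k) m :=
  map_Z_eq k (toFree k) _ (by rw [expCoeff]) (fun m => by simp [toFree]) m

variable [CharZero k]

/-- Both series solve `z' = N z` with constant term 1. -/
theorem ofFree_expCoeff (m : ℕ) : ofFree k (expCoeff k (FreeAlgebra.ι k) m) = Z k m := by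
  have h : (PowerSeries.mk (expCoeff k (FreeAlgebra.ι k : ℕ → _))).map (ofFree k).toRingHom =
      PowerSeries.mk (Z k) := by
    refine eq_of_deriv_eq_mul (x := PowerSeries.mk (newton k)) ?_ (deriv_Z k) ?_ k
    · rw [deriv_map, deriv_expCoeff, map_mul]
      congr 1
      ext m
      simp [ofFree]
    · simp only [← coeff_zero_eq_constantCoeff_apply, coeff_map, coeff_mk, expCoeff, Z, map_one]
  simpa using congrArg (coeff m) h

/-- This one-sided inverse is enough: it gives generation by Newton primitives and brings Lie
elements back from the free algebra. -/
theorem ofFree_toFree (p : NSymm k) : ofFree k (toFree k p) = p := by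
  have h : (ofFree k).comp (toFree k) = AlgHom.id k _ := by
    apply FreeAlgebra.hom_ext
    ext m
    simp only [Function.comp_apply, AlgHom.comp_apply, AlgHom.id_apply]
    rw [← Z_pnat, toFree_Z, ofFree_expCoeff]
  exact DFunLike.congr_fun h p

/-- The exponential-type series is group-like because its image under `Δ` and its tensor square
solve the same equation. -/
theorem freeComul_expCoeff (m : ℕ) : freeComul k ℕ (expCoeff k (FreeAlgebra.ι k) m) =
    ∑ p ∈ Finset.HasAntidiagonal.antidiagonal m,
      expCoeff k (FreeAlgebra.ι k) p.1 ⊗ₜ[k] expCoeff k (FreeAlgebra.ι k) p.2 := by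
  let z := PowerSeries.mk (expCoeff k (FreeAlgebra.ι k : ℕ → FreeAlgebra k ℕ))
  have hz := deriv_expCoeff (k := k) (FreeAlgebra.ι k : ℕ → FreeAlgebra k ℕ)
  have h : z.map (freeComul k ℕ).toRingHom =
      z.map (includeLeft : _ →ₐ[k] FreeAlgebra k ℕ ⊗[k] FreeAlgebra k ℕ).toRingHom *
        z.map (includeRight : _ →ₐ[k] FreeAlgebra k ℕ ⊗[k] FreeAlgebra k ℕ).toRingHom := by
    refine eq_of_deriv_eq_mul ?_ (deriv_map_includeLeft_mul_map_includeRight (k := k) hz) ?_ k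
    · rw [deriv_map, hz, map_mul]
      congr 1
      ext m
      simp
    · rw [map_mul]
      simp only [z, ← coeff_zero_eq_constantCoeff_apply, coeff_map, coeff_mk, expCoeff, map_one,
        mul_one]
  have h' := congrArg (coeff m) h
  rw [coeff_map_includeLeft_mul_map_includeRight] at h'
  simpa [z] using h'

/-- Compatibility with comultiplications carries primitives to primitives, where Friedrichs' theorem
applies. -/
theorem freeComul_toFree (p : NSymm k) :
    freeComul k ℕ (toFree k p) = Algebra.TensorProduct.map (toFree k) (toFree k) (comul k p) := by
  have h : (freeComul k ℕ).comp (toFree k) =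
      (Algebra.TensorProduct.map (toFree k) (toFree k)).comp (comul k) := by
    apply FreeAlgebra.hom_ext
    ext m
    simp only [Function.comp_apply, AlgHom.comp_apply]
    rw [← Z_pnat, toFree_Z, freeComul_expCoeff, comul_Z, map_sum]
    simp only [Algebra.TensorProduct.map_tmul, toFree_Z]
  exact DFunLike.congr_fun h p

/-- The Lie algebra of primitive elements of `NSymm` is generated by the Newton primitives. -/
theorem prim_eq_lieSpan : Prim k = LieSubalgebra.lieSpan k (NSymm k) (Set.range (newton k)) := by
  refine le_antisymm (fun p hp => ?_) (LieSubalgebra.lieSpan_le.2 ?_)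
  · have hp' : comul k p = p ⊗ₜ[k] 1 + 1 ⊗ₜ[k] p := hp
    have h : toFree k p ∈ freeLie k ℕ := by
      apply mem_freeLie_of_primitive
      rw [freeComul_toFree, hp']
      simp
    have h' : ofFree k (toFree k p) ∈
        (freeLie k ℕ).map (ofFree k : FreeAlgebra k ℕ →ₗ⁅k⁆ NSymm k) :=
      ⟨toFree k p, h, rfl⟩
    rw [ofFree_toFree, freeLie, LieSubalgebra.map_lieSpan, ← Set.range_comp] at h'
    convert h' using 3
    ext m
    simp [ofFree]
  · rintro _ ⟨m, rfl⟩
    exact newton_mem_prim k m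

/-- The Newton primitives generate `NSymm` as an algebra. -/
theorem adjoin_newton : Algebra.adjoin k (Set.range (newton k)) = ⊤ := by
  rw [Algebra.adjoin_range_eq_range_freeAlgebra_lift, AlgHom.range_eq_top]
  exact fun p => ⟨toFree k p, ofFree_toFree k p⟩

end Newton

/-! ### Images of the generators under `λ` -/

section Image

variable {k : Type*} [Field k] {n : ℕ} (F : Fin n → P k n)

theorem rep_Z (m : ℕ) : rep F (Z k m) = coeffOp F m :=
  map_Z_eq k (rep F) _ (coeffOp_zero F) (fun m => by simp [rep]) m

theorem rep_newton (m : ℕ) : rep F (newton k m) = wittToEnd k n (signedPow F m) := by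
  rw [map_newton_eq (rep F) (fun m => by rw [rep_Z, PowerSeries.coeff_mk]) (deriv_coeffOp F),
    PowerSeries.coeff_mk]

theorem rightPow_eq_signedPow (m : ℕ) :
    rightPow (derivOf F) (m + 1) = (-1 : k) ^ m • signedPow F m := by
  rw [signedPow, smul_smul, ← mul_pow]
  simp

/-- The signs are units, so they do not affect the span; `signedPow` is shifted by one, matching `m
≥ 1`. -/
theorem lieSpan_signedPow :
    LieSubalgebra.lieSpan k (W k n) (Set.range (signedPow F)) = lieAlg (derivOf F) := by
  refine le_antisymm (LieSubalgebra.lieSpan_le.2 ?_) (LieSubalgebra.lieSpan_le.2 ?_)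
  · rintro _ ⟨m, rfl⟩
    exact LieSubalgebra.smul_mem _ _ (LieSubalgebra.subset_lieSpan ⟨m + 1, by omega, rfl⟩)
  · rintro _ ⟨m, hm, rfl⟩
    obtain ⟨m, rfl⟩ := Nat.exists_eq_add_of_le' hm
    rw [rightPow_eq_signedPow]
    exact LieSubalgebra.smul_mem _ _ (LieSubalgebra.subset_lieSpan ⟨m, rfl⟩)

theorem adjoin_signedPow :
    Algebra.adjoin k (Set.range fun m => wittToEnd k n (signedPow F m)) =
      (assocAlg (derivOf F)).map (Weyl k n).val := by
  rw [assocAlg, AlgHom.map_adjoin]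
  refine le_antisymm (Algebra.adjoin_le_iff.2 ?_) (Algebra.adjoin_le_iff.2 ?_)
  · rintro _ ⟨m, rfl⟩
    change wittToEnd k n (signedPow F m) ∈ _
    rw [signedPow, map_smul]
    refine Subalgebra.smul_mem _ (Algebra.subset_adjoin ?_) _
    exact ⟨_, ⟨m + 1, by omega, rfl⟩, rfl⟩
  · rintro _ ⟨_, ⟨m, hm, rfl⟩, rfl⟩
    obtain ⟨m, rfl⟩ := Nat.exists_eq_add_of_le' hm
    change wittToEnd k n (rightPow (derivOf F) (m + 1)) ∈ _
    rw [rightPow_eq_signedPow, map_smul]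
    exact Subalgebra.smul_mem _ (Algebra.subset_adjoin (Set.mem_range_self m)) _

end Image

end NSymmAction

end

theorem corollary4 {k : Type*} [Field k] [CharZero k] (n : ℕ)
    (F : Fin n → NSymmAction.P k n) :
    (NSymmAction.Prim k).map (NSymmAction.rep F : NSymmAction.NSymm k →ₗ⁅k⁆ Module.End k (NSymmAction.P k n)) =
        (NSymmAction.lieAlg (NSymmAction.derivOf F)).map (NSymmAction.wittToEnd k n) ∧
      (NSymmAction.rep F).range =
        (NSymmAction.assocAlg (NSymmAction.derivOf F)).map (NSymmAction.Weyl k n).val := by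
  constructor
  · rw [NSymmAction.prim_eq_lieSpan, ← NSymmAction.lieSpan_signedPow, LieSubalgebra.map_lieSpan,
      LieSubalgebra.map_lieSpan, ← Set.range_comp, ← Set.range_comp]
    congr 2
    ext1 m
    exact NSymmAction.rep_newton F m
  · rw [← NSymmAction.adjoin_signedPow, ← Algebra.map_top, ← NSymmAction.adjoin_newton,
      AlgHom.map_adjoin, ← Set.range_comp]
    congr 2
    ext1 m
    exact NSymmAction.rep_newton F m
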